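/- For real $\nu$ and $x>0$ let $$I_\nu(x)=\sum_{k=0}^{\infty}\frac{(x/2)^{2k+\nu}}{k!\,\Gamma(k+\nu+1)},\qquad K_\nu(x)=\int_0^\infty e^{-x\cosh t}\cosh(\nu t)\,dt$$ be the modified Bessel functions of the first and second kind of order $\nu$, and let a prime denote the derivative with respect to the argument $x$ (with $\nu$ fixed). Then there exist constants $A_1>0$ and $A_2>0$ and a function $M:(0,\infty)\to(0,\infty)$ such that: 1. for every real $z$ with $0<z<A_1$, the function $\nu\mapsto I_\nu'(\nu z)\,K_\nu'(\nu z)$ is strictly increasing on $[2,\infty)$; 2. for every real $z>A_2$, the function $\nu\mapsto I_\nu'(\nu z)\,K_\nu'(\nu z)$ is strictly increasing on $[2,\infty)$; 3. for every real $z>0$, the function $\nu\mapsto I_\nu'(\nu z)\,K_\nu'(\nu z)$ is strictly increasing on $(M(z),\infty)$. Here $\nu$ ranges over real numbers. -/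

import Mathlib

open Set MeasureTheory

noncomputable section

/-- The modified Bessel function of the first kind `I_ν(x)` for real order `ν` and real argument
`x > 0`, given by its (everywhere convergent) power series
`I_ν(x) = ∑_{k ≥ 0} (x/2)^(2k+ν) / (k! Γ(k+ν+1))`. -/
def besselI (ν x : ℝ) : ℝ :=
  ∑' k : ℕ, (x / 2) ^ (2 * (k : ℝ) + ν) / ((k.factorial : ℝ) * Real.Gamma ((k : ℝ) + ν + 1))

/-- The modified Bessel function of the second kind (Macdonald function) `K_ν(x)` for real order
`ν` and real argument `x > 0`, given by its (absolutely convergent) integral representation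
`K_ν(x) = ∫_0^∞ exp(-x cosh t) cosh(ν t) dt`, which covers integer and non-integer orders alike. -/
def besselK (ν x : ℝ) : ℝ :=
  ∫ t in Ioi (0 : ℝ), Real.exp (-x * Real.cosh t) * Real.cosh (ν * t)

/-- The product `I_ν'(ν z) K_ν'(ν z)`; the prime is the derivative with respect to the argument
(the order `ν` being kept fixed), evaluated at the point `ν z`. -/
def besselDerivProd (z ν : ℝ) : ℝ :=
  deriv (besselI ν) (ν * z) * deriv (besselK ν) (ν * z)

end

/-! Write w = x I_ν'(x) and m = -x K_ν'(x) at x = νz, so that -I_ν' K_ν' = w m / (νz)². The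
Wronskian I m + w K = 1 linearises the reciprocal: ν²/(w m) = ν² I/w + ν² K/m. It therefore suffices
that each summand is strictly increasing in ν for fixed z.

This is a Sturm-type comparison in z. With θ = z d/dz, the rescaled equation reads θI = w, θw = ν²(1
+ z²) I, and θK = -m, θm = -ν²(1 + z²) K. For orders a < b, the terms with 1 + z² cancel in θ(a² I_a
w_b - b² I_b w_a), leaving (a² - b²) w_a w_b < 0; as the difference vanishes at z = 0, it is
negative. For K the derivative is (b² - a²) m_a m_b > 0 and the difference vanishes at infinity, so
it is again negative (`besselI_cross_lt`, `besselK_cross_lt`).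

No restriction on z > 0 appears, and ν > 1 suffices. The rest derives the analytic facts from the
series and the integral. -/

open Filter Topology

/-! ### Macdonald function: integrability, recurrence, Bessel equation. -/

section Macdonald

theorem cosh_mul_le_exp_abs (ν : ℝ) {t : ℝ} (ht : 0 ≤ t) : Real.cosh (ν * t) ≤ Real.exp (|ν| * t) := by
  rw [← Real.cosh_abs, abs_mul, abs_of_nonneg ht, Real.cosh_eq]
  have : Real.exp (-(|ν| * t)) ≤ Real.exp (|ν| * t) := by
    apply Real.exp_le_exp.2
    have : 0 ≤ |ν| * t := by positivity
    linarith
  linarith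

/-- Follows from cosh t ≥ exp(t/2)²/2 ≥ (1 + t/2)²/2. Quadratic growth is enough to beat the linear
exponent |ν| t. -/
theorem sq_div_eight_le_cosh {t : ℝ} (ht : 0 ≤ t) : t ^ 2 / 8 ≤ Real.cosh t := by
  have h1 : t / 2 + 1 ≤ Real.exp (t / 2) := Real.add_one_le_exp _
  have h2 : Real.exp t = Real.exp (t / 2) ^ 2 := by
    rw [← Real.exp_nat_mul]; congr 1; push_cast; ring
  have h3 := Real.exp_pos (-t)
  rw [Real.cosh_eq, h2]
  nlinarith

theorem besselK_integrand_le {ν x t : ℝ} (hx : 0 < x) (ht : 0 ≤ t) :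
    Real.exp (-x * Real.cosh t) * Real.cosh (ν * t) ≤
      Real.exp (2 * (|ν| + 1) ^ 2 / x) * Real.exp (-t) := by
  calc _ ≤ Real.exp (-x * Real.cosh t) * Real.exp (|ν| * t) := by
        gcongr; exact cosh_mul_le_exp_abs ν ht
    _ ≤ _ := by
        rw [← Real.exp_add, ← Real.exp_add, Real.exp_le_exp]
        have h1 : x * (t ^ 2 / 8) ≤ x * Real.cosh t := by gcongr; exact sq_div_eight_le_cosh ht
        have h2 : (|ν| + 1) * t ≤ x * (t ^ 2 / 8) + 2 * (|ν| + 1) ^ 2 / x := by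
          rw [← sub_nonneg]
          -- Completing the square in t explains the constant 2(|ν| + 1)²/x.
          have : x * (t ^ 2 / 8) + 2 * (|ν| + 1) ^ 2 / x - (|ν| + 1) * t
              = (x * t - 4 * (|ν| + 1)) ^ 2 / (8 * x) := by field_simp; ring
          rw [this]; positivity
        linarith

theorem continuous_besselK_integrand (ν x : ℝ) :
    Continuous fun t => Real.exp (-x * Real.cosh t) * Real.cosh (ν * t) := by
  have := Real.continuous_cosh
  fun_prop

theorem integrableOn_besselK_integrand (ν : ℝ) {x : ℝ} (hx : 0 < x) :
    IntegrableOn (fun t => Real.exp (-x * Real.cosh t) * Real.cosh (ν * t)) (Ioi 0) := by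
  have h : IntegrableOn (fun t : ℝ => Real.exp (2 * (|ν| + 1) ^ 2 / x) * Real.exp (-t)) (Ioi 0) := by
    have := (exp_neg_integrableOn_Ioi 0 one_pos).const_mul (Real.exp (2 * (|ν| + 1) ^ 2 / x))
    simpa [IntegrableOn] using this
  refine Integrable.mono' h (continuous_besselK_integrand ν x).aestronglyMeasurable ?_
  refine (ae_restrict_iff' measurableSet_Ioi).2 (ae_of_all _ fun t ht => ?_)
  rw [Real.norm_of_nonneg (mul_nonneg (Real.exp_pos _).le (Real.cosh_pos _).le)]
  exact besselK_integrand_le hx (le_of_lt ht)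

theorem besselK_pos (ν : ℝ) {x : ℝ} (hx : 0 < x) : 0 < besselK ν x := by
  unfold besselK
  have hpos : ∀ t : ℝ, 0 < Real.exp (-x * Real.cosh t) * Real.cosh (ν * t) := fun t =>
    mul_pos (Real.exp_pos _) (Real.cosh_pos _)
  rw [setIntegral_pos_iff_support_of_nonneg_ae (ae_of_all _ fun t => (hpos t).le)
    (integrableOn_besselK_integrand ν hx)]
  have : Function.support (fun t => Real.exp (-x * Real.cosh t) * Real.cosh (ν * t)) = univ := by
    ext t; simp [(Real.cosh_pos _).ne']
  rw [this]; simp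

theorem cosh_mul_cosh_mul (ν t : ℝ) :
    Real.cosh t * Real.cosh (ν * t) = (Real.cosh ((ν + 1) * t) + Real.cosh ((ν - 1) * t)) / 2 := by
  rw [add_mul, sub_mul, one_mul, Real.cosh_add, Real.cosh_sub]; ring

theorem sinh_mul_sinh_mul (ν t : ℝ) :
    Real.sinh t * Real.sinh (ν * t) = (Real.cosh ((ν + 1) * t) - Real.cosh ((ν - 1) * t)) / 2 := by
  rw [add_mul, sub_mul, one_mul, Real.cosh_add, Real.cosh_sub]; ring

theorem hasDerivAt_besselK_avg (ν : ℝ) {x : ℝ} (hx : 0 < x) :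
    HasDerivAt (besselK ν) (-((besselK (ν + 1) x + besselK (ν - 1) x) / 2)) x := by
  have hsum : ∀ y t : ℝ, Real.exp (-y * Real.cosh t) * (Real.cosh t * Real.cosh (ν * t))
      = (Real.exp (-y * Real.cosh t) * Real.cosh ((ν + 1) * t)
        + Real.exp (-y * Real.cosh t) * Real.cosh ((ν - 1) * t)) / 2 := by
    intro y t; rw [cosh_mul_cosh_mul]; ring
  have hint : ∀ {y : ℝ}, 0 < y → IntegrableOn
      (fun t => Real.exp (-y * Real.cosh t) * (Real.cosh t * Real.cosh (ν * t))) (Ioi 0) := by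
    intro y hy
    simp_rw [hsum]
    exact ((integrableOn_besselK_integrand _ hy).add (integrableOn_besselK_integrand _ hy)).div_const 2
  have key := (hasDerivAt_integral_of_dominated_loc_of_deriv_le
    (μ := volume.restrict (Ioi (0 : ℝ))) (s := Ioi (x / 2))
    (F := fun y t => Real.exp (-y * Real.cosh t) * Real.cosh (ν * t))
    (F' := fun y t => -(Real.exp (-y * Real.cosh t) * (Real.cosh t * Real.cosh (ν * t))))
    -- On y > x/2 the differentiated integrand is largest at the left end, so its value there
    -- dominates.
    (bound := fun t => Real.exp (-(x / 2) * Real.cosh t) * (Real.cosh t * Real.cosh (ν * t)))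
    (x₀ := x) (Ioi_mem_nhds (by linarith))
    (Eventually.of_forall fun y => (continuous_besselK_integrand ν y).aestronglyMeasurable)
    (integrableOn_besselK_integrand ν hx)
    (hint hx).neg.aestronglyMeasurable
    (ae_of_all _ fun t y hy => ?_) (hint (half_pos hx)) (ae_of_all _ fun t y _ => ?_)).2
  · refine key.congr_deriv ?_
    rw [integral_neg]
    simp_rw [hsum]
    rw [integral_div, integral_add (integrableOn_besselK_integrand _ hx)
      (integrableOn_besselK_integrand _ hx)]
    rfl
  · have h1 := Real.cosh_pos t
    have h2 := Real.cosh_pos (ν * t)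
    rw [norm_neg, Real.norm_of_nonneg (by positivity)]
    have : x / 2 ≤ y := le_of_lt hy
    gcongr
  · have : HasDerivAt (fun y : ℝ => -y * Real.cosh t) (-Real.cosh t) y := by
      simpa using (hasDerivAt_id y).neg.mul_const (Real.cosh t)
    refine (this.exp.mul_const (Real.cosh (ν * t))).congr_deriv ?_
    ring

/-- Integration by parts: exp(-x cosh t) sinh(νt) vanishes at t = 0 and at infinity, so its
derivative integrates to zero. -/
theorem besselK_recurrence (ν : ℝ) {x : ℝ} (hx : 0 < x) :
    x * (besselK (ν + 1) x - besselK (ν - 1) x) = 2 * ν * besselK ν x := by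
  have hderiv : ∀ t ∈ Ioi (0 : ℝ), HasDerivAt (fun t => Real.exp (-x * Real.cosh t) * Real.sinh (ν * t))
      (ν * (Real.exp (-x * Real.cosh t) * Real.cosh (ν * t))
        - x / 2 * (Real.exp (-x * Real.cosh t) * Real.cosh ((ν + 1) * t)
          - Real.exp (-x * Real.cosh t) * Real.cosh ((ν - 1) * t))) t := by
    intro t _
    have h1 : HasDerivAt (fun t => Real.exp (-x * Real.cosh t))
        (Real.exp (-x * Real.cosh t) * (-x * Real.sinh t)) t :=
      ((Real.hasDerivAt_cosh t).const_mul (-x)).exp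
    have h2 : HasDerivAt (fun t => Real.sinh (ν * t)) (Real.cosh (ν * t) * ν) t := by
      have : HasDerivAt (fun t => ν * t) ν t := by simpa using (hasDerivAt_id t).const_mul ν
      exact this.sinh
    refine (h1.mul h2).congr_deriv ?_
    linear_combination -x * Real.exp (-x * Real.cosh t) * sinh_mul_sinh_mul ν t
  have i0 := integrableOn_besselK_integrand ν hx
  have i1 := integrableOn_besselK_integrand (ν + 1) hx
  have i2 := integrableOn_besselK_integrand (ν - 1) hx
  have hlim : Tendsto (fun t => Real.exp (-x * Real.cosh t) * Real.sinh (ν * t)) atTop (𝓝 0) := by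
    have hb : Tendsto (fun t => Real.exp (2 * (|ν| + 1) ^ 2 / x) * Real.exp (-t)) atTop (𝓝 0) := by
      simpa using (Real.tendsto_exp_neg_atTop_nhds_zero).const_mul (Real.exp (2 * (|ν| + 1) ^ 2 / x))
    refine squeeze_zero_norm' ?_ hb
    filter_upwards [eventually_ge_atTop 0] with t ht
    refine le_trans ?_ (besselK_integrand_le (ν := ν) hx ht)
    rw [norm_mul, Real.norm_of_nonneg (Real.exp_pos _).le]
    gcongr
    rw [Real.norm_eq_abs, abs_le]
    rw [Real.sinh_eq, Real.cosh_eq]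
    constructor <;> linarith [Real.exp_pos (ν * t), Real.exp_pos (-(ν * t))]
  have hc : Continuous fun t => Real.exp (-x * Real.cosh t) * Real.sinh (ν * t) := by
    have := Real.continuous_cosh
    have := Real.continuous_sinh
    fun_prop
  have i3 : IntegrableOn (fun t => Real.exp (-x * Real.cosh t) * Real.cosh ((ν + 1) * t)
      - Real.exp (-x * Real.cosh t) * Real.cosh ((ν - 1) * t)) (Ioi 0) := i1.sub i2
  have key := integral_Ioi_of_hasDerivAt_of_tendsto hc.continuousWithinAt hderiv
    ((i0.const_mul ν).sub (i3.const_mul (x / 2))) hlim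
  rw [integral_sub (i0.const_mul ν) (i3.const_mul (x / 2)), integral_const_mul,
    integral_const_mul, integral_sub i1 i2] at key
  simp only [mul_zero, Real.sinh_zero, sub_zero] at key
  change ν * besselK ν x - x / 2 * (besselK (ν + 1) x - besselK (ν - 1) x) = 0 at key
  linarith

/-- The Euler derivative `-x K_ν'(x)` of the Macdonald function, with its sign reversed. -/
noncomputable def besselKEuler (ν x : ℝ) : ℝ := x * ((besselK (ν + 1) x + besselK (ν - 1) x) / 2)

theorem besselKEuler_pos (ν : ℝ) {x : ℝ} (hx : 0 < x) : 0 < besselKEuler ν x := by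
  have := besselK_pos (ν + 1) hx
  have := besselK_pos (ν - 1) hx
  unfold besselKEuler; positivity

theorem hasDerivAt_besselK (ν : ℝ) {x : ℝ} (hx : 0 < x) :
    HasDerivAt (besselK ν) (-besselKEuler ν x / x) x := by
  refine (hasDerivAt_besselK_avg ν hx).congr_deriv ?_
  unfold besselKEuler; field_simp

theorem besselKEuler_eq (ν : ℝ) {x : ℝ} (hx : 0 < x) :
    besselKEuler ν x = x * besselK (ν + 1) x - ν * besselK ν x := by
  unfold besselKEuler; linarith [besselK_recurrence ν hx]

theorem besselKEuler_add_one (ν : ℝ) {x : ℝ} (hx : 0 < x) :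
    besselKEuler (ν + 1) x = x * besselK ν x + (ν + 1) * besselK (ν + 1) x := by
  have := besselK_recurrence (ν + 1) hx
  unfold besselKEuler
  rw [add_sub_cancel_right] at *
  linarith

/-- Together with `hasDerivAt_besselK`, this is the modified Bessel equation as a first-order
system. -/
theorem hasDerivAt_besselKEuler (ν : ℝ) {x : ℝ} (hx : 0 < x) :
    HasDerivAt (besselKEuler ν) (-((x ^ 2 + ν ^ 2) * besselK ν x) / x) x := by
  have h : HasDerivAt (fun y => y * besselK (ν + 1) y - ν * besselK ν y)
      (1 * besselK (ν + 1) x + x * (-besselKEuler (ν + 1) x / x)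
        - ν * (-besselKEuler ν x / x)) x :=
    ((hasDerivAt_id x).mul (hasDerivAt_besselK (ν + 1) hx)).sub
      ((hasDerivAt_besselK ν hx).const_mul ν)
  have h' : HasDerivAt (besselKEuler ν) _ x := h.congr_of_eventuallyEq (by
    filter_upwards [lt_mem_nhds hx] with y hy using besselKEuler_eq ν hy)
  refine h'.congr_deriv ?_
  rw [besselKEuler_add_one ν hx, besselKEuler_eq ν hx]
  field_simp
  ring

/-! ### Decay of K at infinity. -/

theorem besselK_le_exp (ν : ℝ) {x : ℝ} (hx : 1 ≤ x) :
    besselK ν x ≤ Real.exp (-(x - 1)) * besselK ν 1 := by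
  unfold besselK
  rw [← integral_const_mul]
  refine setIntegral_mono (integrableOn_besselK_integrand ν (by linarith))
    ((integrableOn_besselK_integrand ν one_pos).const_mul _) fun t => ?_
  have h := Real.cosh_pos (ν * t)
  simp only
  rw [← mul_assoc, ← Real.exp_add]
  gcongr
  nlinarith [Real.one_le_cosh t]

theorem tendsto_mul_besselK_atTop (ν : ℝ) : Tendsto (fun x => x * besselK ν x) atTop (𝓝 0) := by
  have hb : Tendsto (fun x : ℝ => (x ^ 1 * Real.exp (-x)) * (Real.exp 1 * besselK ν 1)) atTop (𝓝 0) := by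
    simpa using (Real.tendsto_pow_mul_exp_neg_atTop_nhds_zero 1).mul_const (Real.exp 1 * besselK ν 1)
  refine squeeze_zero' ?_ ?_ hb
  · filter_upwards [eventually_ge_atTop 1] with x hx
    have := besselK_pos ν (show 0 < x by linarith)
    positivity
  · filter_upwards [eventually_ge_atTop 1] with x hx
    calc x * besselK ν x ≤ x * (Real.exp (-(x - 1)) * besselK ν 1) := by
          gcongr; exact besselK_le_exp ν hx
      _ = _ := by
          rw [show -(x - 1) = -x + 1 by ring, Real.exp_add]; ring

theorem tendsto_besselK_atTop (ν : ℝ) : Tendsto (besselK ν) atTop (𝓝 0) := by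
  refine squeeze_zero' ?_ ?_ (tendsto_mul_besselK_atTop ν)
  · filter_upwards [eventually_ge_atTop 1] with x hx
    exact (besselK_pos ν (show 0 < x by linarith)).le
  · filter_upwards [eventually_ge_atTop 1] with x hx
    have := besselK_pos ν (show 0 < x by linarith)
    nlinarith

theorem tendsto_besselKEuler_atTop (ν : ℝ) : Tendsto (besselKEuler ν) atTop (𝓝 0) := by
  have := ((tendsto_mul_besselK_atTop (ν + 1)).add (tendsto_mul_besselK_atTop (ν - 1))).div_const 2
  rw [add_zero, zero_div] at this
  refine this.congr fun x => ?_
  unfold besselKEuler; ring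

/-! ### Leading behaviour of K at the origin. -/

/-- Euler's integral after the substitution u = exp s. -/
theorem integrable_exp_sub_exp {ν : ℝ} (hν : 0 < ν) :
    Integrable (fun s : ℝ => Real.exp (ν * s - Real.exp s)) ∧
      ∫ s : ℝ, Real.exp (ν * s - Real.exp s) = Real.Gamma ν := by
  have hd : ∀ s ∈ (univ : Set ℝ), HasDerivWithinAt Real.exp (Real.exp s) univ s := fun s _ =>
    (Real.hasDerivAt_exp s).hasDerivWithinAt
  have himg : Real.exp '' univ = Ioi 0 := by rw [image_univ, Real.range_exp]
  have heq : ∀ s : ℝ, |Real.exp s| • (Real.exp (-Real.exp s) * Real.exp s ^ (ν - 1))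
      = Real.exp (ν * s - Real.exp s) := by
    intro s
    rw [abs_of_pos (Real.exp_pos s), smul_eq_mul, ← Real.exp_mul, ← Real.exp_add, ← Real.exp_add]
    congr 1; ring
  constructor
  · have := (integrableOn_image_iff_integrableOn_abs_deriv_smul MeasurableSet.univ hd
      Real.exp_injective.injOn (fun u => Real.exp (-u) * u ^ (ν - 1))).1
      (by rw [himg]; exact Real.GammaIntegral_convergent hν)
    simp_rw [heq] at this
    exact integrableOn_univ.1 this
  · have := integral_image_eq_integral_abs_deriv_smul MeasurableSet.univ hd
      Real.exp_injective.injOn (fun u => Real.exp (-u) * u ^ (ν - 1))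
    simp_rw [heq, himg] at this
    rw [Real.Gamma_eq_integral hν, this, setIntegral_univ]

theorem neg_mul_cosh_sub_log_add {x : ℝ} (hx : 0 < x) (ν s : ℝ) :
    -x * Real.cosh (s - Real.log (x / 2)) + ν * (s - Real.log (x / 2))
      = (ν * s - Real.exp s - x ^ 2 / 4 * Real.exp (-s)) - ν * Real.log (x / 2) := by
  have h2 : 0 < x / 2 := by positivity
  rw [Real.cosh_eq, neg_sub, Real.exp_sub, Real.exp_sub, Real.exp_log h2, Real.exp_neg]
  have := Real.exp_pos s
  field_simp
  ring

/-- Shifting the variable by `log (x / 2)` removes the singularity of `K_ν` at the origin. -/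
theorem two_mul_besselK_eq {ν x : ℝ} (hν : 0 < ν) (hx : 0 < x) :
    (x / 2) ^ ν * (2 * besselK ν x)
      = ∫ s : ℝ, Real.exp (ν * s - Real.exp s - x ^ 2 / 4 * Real.exp (-s)) := by
  have h2 : 0 < x / 2 := by positivity
  have hg : Integrable (fun s : ℝ => Real.exp (ν * s - Real.exp s - x ^ 2 / 4 * Real.exp (-s))) := by
    refine (integrable_exp_sub_exp hν).1.mono' (by fun_prop) (ae_of_all _ fun s => ?_)
    rw [Real.norm_of_nonneg (Real.exp_pos _).le]
    refine Real.exp_le_exp.2 ?_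
    have := Real.exp_pos (-s)
    have : 0 ≤ x ^ 2 / 4 * Real.exp (-s) := by positivity
    linarith
  have hshift : ∀ s : ℝ, Real.exp (-x * Real.cosh (s - Real.log (x / 2)) + ν * (s - Real.log (x / 2)))
      = Real.exp (ν * s - Real.exp s - x ^ 2 / 4 * Real.exp (-s)) * ((x / 2) ^ ν)⁻¹ := by
    intro s
    rw [neg_mul_cosh_sub_log_add hx, Real.exp_sub _ (ν * _), Real.rpow_def_of_pos h2,
      mul_comm (Real.log _), div_eq_mul_inv]
  have hf : Integrable (fun t : ℝ => Real.exp (-x * Real.cosh t + ν * t)) := by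
    have := (hg.mul_const ((x / 2) ^ ν)⁻¹)
    simp_rw [← hshift] at this
    simpa using this.comp_add_right (Real.log (x / 2))
  have hf' : Integrable (fun t : ℝ => Real.exp (-x * Real.cosh t + ν * -t)) := by
    simpa using hf.comp_neg
  have h1 : 2 * besselK ν x = ∫ t : ℝ, Real.exp (-x * Real.cosh t) * Real.cosh (ν * t) := by
    unfold besselK
    rw [← integral_comp_abs (f := fun t => Real.exp (-x * Real.cosh t) * Real.cosh (ν * t))]
    congr 1; ext t
    rw [Real.cosh_abs]
    congr 1
    rw [← Real.cosh_abs (ν * |t|), ← Real.cosh_abs (ν * t), abs_mul, abs_mul, abs_abs]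
  have h3 : ∫ t : ℝ, Real.exp (-x * Real.cosh t + ν * -t) = ∫ t : ℝ, Real.exp (-x * Real.cosh t + ν * t) := by
    rw [← integral_neg_eq_self (fun t : ℝ => Real.exp (-x * Real.cosh t + ν * t))]
    simp
  have h4 : 2 * besselK ν x = ∫ t : ℝ, Real.exp (-x * Real.cosh t + ν * t) := by
    rw [h1]
    have : ∀ t : ℝ, Real.exp (-x * Real.cosh t) * Real.cosh (ν * t)
        = (Real.exp (-x * Real.cosh t + ν * t) + Real.exp (-x * Real.cosh t + ν * -t)) / 2 := by
      intro t
      rw [Real.cosh_eq (ν * t), Real.exp_add, Real.exp_add, mul_neg]; ring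
    simp_rw [this]
    rw [integral_div, integral_add hf hf', h3]; ring
  rw [h4, ← integral_sub_right_eq_self _ (Real.log (x / 2))]
  simp_rw [hshift]
  rw [integral_mul_const, mul_comm, mul_assoc, inv_mul_cancel₀ (Real.rpow_pos_of_pos h2 ν).ne', mul_one]

theorem tendsto_rpow_mul_besselK {ν : ℝ} (hν : 0 < ν) :
    Tendsto (fun x => (x / 2) ^ ν * (2 * besselK ν x)) (𝓝[>] 0) (𝓝 (Real.Gamma ν)) := by
  have key : Tendsto (fun x : ℝ => ∫ s : ℝ, Real.exp (ν * s - Real.exp s - x ^ 2 / 4 * Real.exp (-s)))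
      (𝓝[>] 0) (𝓝 (∫ s : ℝ, Real.exp (ν * s - Real.exp s))) := by
    refine tendsto_integral_filter_of_dominated_convergence
      (fun s => Real.exp (ν * s - Real.exp s)) (Eventually.of_forall fun x => by fun_prop)
      (Eventually.of_forall fun x => ae_of_all _ fun s => ?_) (integrable_exp_sub_exp hν).1
      (ae_of_all _ fun s => ?_)
    · rw [Real.norm_of_nonneg (Real.exp_pos _).le]
      refine Real.exp_le_exp.2 ?_
      have := Real.exp_pos (-s)
      have : 0 ≤ x ^ 2 / 4 * Real.exp (-s) := by positivity
      linarith
    · have hc : Continuous fun x : ℝ => Real.exp (ν * s - Real.exp s - x ^ 2 / 4 * Real.exp (-s)) := by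
        fun_prop
      simpa using (hc.tendsto 0).mono_left nhdsWithin_le_nhds
  rw [(integrable_exp_sub_exp hν).2] at key
  refine key.congr' ?_
  filter_upwards [self_mem_nhdsWithin] with x hx using (two_mul_besselK_eq hν hx).symm

/-- Order ν + 1 carries the limit; order ν - 1 enters with an extra factor (x/2)² and drops out. The
condition ν > 1 keeps ν - 1 positive. -/
theorem tendsto_rpow_mul_besselKEuler {ν : ℝ} (hν : 1 < ν) :
    Tendsto (fun x => (x / 2) ^ ν * (2 * besselKEuler ν x)) (𝓝[>] 0) (𝓝 (Real.Gamma (ν + 1))) := by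
  have hsq : Tendsto (fun x : ℝ => (x / 2) ^ 2) (𝓝[>] 0) (𝓝 0) := by
    have hc : Continuous fun x : ℝ => (x / 2) ^ 2 := by fun_prop
    simpa using (hc.tendsto 0).mono_left nhdsWithin_le_nhds
  have h := (tendsto_rpow_mul_besselK (show 0 < ν + 1 by linarith)).add
    (hsq.mul (tendsto_rpow_mul_besselK (show 0 < ν - 1 by linarith)))
  rw [zero_mul, add_zero] at h
  refine h.congr' ?_
  filter_upwards [self_mem_nhdsWithin] with x hx
  have h2 : 0 < x / 2 := half_pos hx
  rw [Real.rpow_add h2, Real.rpow_sub h2, Real.rpow_one]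
  unfold besselKEuler
  have : x ≠ 0 := (ne_of_gt hx)
  field_simp

end Macdonald

/-! ### First kind: power series, Bessel equation, limits at the origin. -/

section FirstKind

/-- The entire factor of `I_ν`: one has `I_ν(x) = (x/2)^ν Ψ_ν(x²/4)`. -/
noncomputable def besselISeries (ν y : ℝ) : ℝ :=
  ∑' k : ℕ, y ^ k / ((k.factorial : ℝ) * Real.Gamma ((k : ℝ) + ν + 1))

theorem Gamma_le_Gamma_natCast_add {ν : ℝ} (hν : 0 ≤ ν) (k : ℕ) :
    Real.Gamma (ν + 1) ≤ Real.Gamma ((k : ℝ) + ν + 1) := by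
  induction k with
  | zero => simp
  | succ k ih =>
    have hk : (0 : ℝ) ≤ k := k.cast_nonneg
    have hp : 0 < Real.Gamma ((k : ℝ) + ν + 1) := Real.Gamma_pos_of_pos (by linarith)
    have : Real.Gamma (((k + 1 : ℕ) : ℝ) + ν + 1) = (k + ν + 1) * Real.Gamma (k + ν + 1) := by
      rw [← Real.Gamma_add_one (by linarith)]; congr 1; push_cast; ring
    rw [this]
    nlinarith

theorem summable_besselISeries {ν : ℝ} (hν : 0 ≤ ν) (y : ℝ) :
    Summable fun k : ℕ => y ^ k / ((k.factorial : ℝ) * Real.Gamma ((k : ℝ) + ν + 1)) := by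
  have hG : 0 < Real.Gamma (ν + 1) := Real.Gamma_pos_of_pos (by linarith)
  refine Summable.of_norm_bounded ((Real.summable_pow_div_factorial |y|).div_const (Real.Gamma (ν + 1)))
    fun k => ?_
  have h1 := Gamma_le_Gamma_natCast_add hν k
  have h2 : (0 : ℝ) < k.factorial := by exact_mod_cast k.factorial_pos
  rw [norm_div, norm_pow, Real.norm_eq_abs, norm_mul, Real.norm_of_nonneg h2.le,
    Real.norm_of_nonneg (hG.le.trans h1), div_div]
  gcongr

theorem hasDerivAt_besselISeries {ν : ℝ} (hν : 0 ≤ ν) (y : ℝ) :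
    HasDerivAt (besselISeries ν) (besselISeries (ν + 1) y) y := by
  have hterm : ∀ (k : ℕ) (z : ℝ), ((k + 1 : ℕ) : ℝ) * z ^ k
      / (((k + 1).factorial : ℝ) * Real.Gamma (((k + 1 : ℕ) : ℝ) + ν + 1))
      = z ^ k / ((k.factorial : ℝ) * Real.Gamma ((k : ℝ) + (ν + 1) + 1)) := by
    intro k z
    have h2 : (0 : ℝ) < k.factorial := by exact_mod_cast k.factorial_pos
    have hk : (0 : ℝ) ≤ k := k.cast_nonneg
    have h3 : 0 < Real.Gamma ((k : ℝ) + (ν + 1) + 1) := Real.Gamma_pos_of_pos (by linarith)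
    rw [show ((k + 1 : ℕ) : ℝ) + ν + 1 = (k : ℝ) + (ν + 1) + 1 by push_cast; ring,
      Nat.factorial_succ]
    push_cast
    field_simp
  -- The ball of radius R contains y, and the differentiated series at R dominates throughout it.
  set R := |y| + 1
  have hR : 0 ≤ R := by positivity
  let g' : ℕ → ℝ → ℝ := fun k z => (k : ℝ) * z ^ (k - 1)
    / ((k.factorial : ℝ) * Real.Gamma ((k : ℝ) + ν + 1))
  have hsum : ∀ z, Summable fun k => g' k z := by
    intro z
    rw [← summable_nat_add_iff 1]
    refine (summable_besselISeries (show 0 ≤ ν + 1 by linarith) z).congr fun k => ?_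
    exact (hterm k z).symm
  have key := hasDerivAt_tsum_of_isPreconnected (hsum R) (t := Metric.ball (0 : ℝ) R)
    Metric.isOpen_ball (convex_ball (0 : ℝ) R).isPreconnected
    (g := fun (k : ℕ) z => z ^ k / ((k.factorial : ℝ) * Real.Gamma ((k : ℝ) + ν + 1)))
    (g' := g') (y₀ := y) (y := y)
    (fun k z _ => (hasDerivAt_pow k z).div_const _) (fun k z hz => ?_)
    (by simp [R]) (summable_besselISeries hν y) (by simp [R])
  · refine key.congr_deriv ?_
    rw [(hsum y).tsum_eq_zero_add]
    simp only [g', Nat.cast_zero, zero_mul, zero_div, zero_add, add_tsub_cancel_right]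
    unfold besselISeries
    congr 1; ext k
    exact hterm k y
  · have hk : (0 : ℝ) ≤ k := k.cast_nonneg
    have h3 : 0 < Real.Gamma ((k : ℝ) + ν + 1) := Real.Gamma_pos_of_pos (by linarith)
    have h2 : (0 : ℝ) < k.factorial := by exact_mod_cast k.factorial_pos
    have hz' : |z| ≤ R := by simpa using (Metric.mem_ball.1 hz).le
    simp only [g']
    rw [norm_div, norm_mul, norm_pow, Real.norm_eq_abs z, Real.norm_of_nonneg hk,
      Real.norm_of_nonneg (mul_pos h2 h3).le]
    gcongr

/-- Coefficientwise, Γ(k+ν+2) = (k+ν+1) Γ(k+ν+1), with k+ν+1 split as (ν+1) + k; the k part cancels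
against k! and shifts the index. -/
theorem besselISeries_recurrence {ν : ℝ} (hν : 0 ≤ ν) (y : ℝ) :
    besselISeries ν y = (ν + 1) * besselISeries (ν + 1) y + y * besselISeries (ν + 2) y := by
  have s0 := summable_besselISeries hν y
  have s1 := summable_besselISeries (show 0 ≤ ν + 1 by linarith) y
  have s2 := summable_besselISeries (show 0 ≤ ν + 2 by linarith) y
  have s1' : Summable fun k : ℕ => (ν + 1) * (y ^ (k + 1)
      / (((k + 1).factorial : ℝ) * Real.Gamma (((k + 1 : ℕ) : ℝ) + (ν + 1) + 1))) :=
    (summable_nat_add_iff 1).2 (s1.mul_left (ν + 1))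
  unfold besselISeries
  rw [← tsum_mul_left, ← tsum_mul_left, s0.tsum_eq_zero_add,
    (s1.mul_left (ν + 1)).tsum_eq_zero_add, add_assoc ((ν + 1) * _), ← s1'.tsum_add (s2.mul_left y)]
  congr 1
  · have : Real.Gamma (ν + 1 + 1) = (ν + 1) * Real.Gamma (ν + 1) := Real.Gamma_add_one (by linarith)
    have h1 : 0 < Real.Gamma (ν + 1) := Real.Gamma_pos_of_pos (by linarith)
    simp [this]
    field_simp
  · congr 1; ext k
    have hk : (0 : ℝ) ≤ k := k.cast_nonneg
    have h2 : (0 : ℝ) < k.factorial := by exact_mod_cast k.factorial_pos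
    have h3 : 0 < Real.Gamma ((k : ℝ) + ν + 2) := Real.Gamma_pos_of_pos (by linarith)
    have h4 : Real.Gamma ((k : ℝ) + ν + 3) = (k + ν + 2) * Real.Gamma ((k : ℝ) + ν + 2) := by
      rw [← Real.Gamma_add_one (by linarith)]; congr 1; ring
    have h5 : (0 : ℝ) < k + ν + 2 := by linarith
    push_cast
    rw [show (k : ℝ) + 1 + ν + 1 = k + ν + 2 by ring,
      show (k : ℝ) + 1 + (ν + 1) + 1 = k + ν + 3 by ring,
      show (k : ℝ) + (ν + 2) + 1 = k + ν + 3 by ring, h4, Nat.factorial_succ]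
    push_cast
    field_simp
    ring

theorem besselISeries_pos {ν y : ℝ} (hν : 0 ≤ ν) (hy : 0 ≤ y) : 0 < besselISeries ν y := by
  refine (summable_besselISeries hν y).tsum_pos (fun k => ?_) 0 ?_
  · have hk : (0 : ℝ) ≤ k := k.cast_nonneg
    have h3 : 0 < Real.Gamma ((k : ℝ) + ν + 1) := Real.Gamma_pos_of_pos (by linarith)
    positivity
  · have h3 : 0 < Real.Gamma (ν + 1) := Real.Gamma_pos_of_pos (by linarith)
    simpa using h3

theorem besselISeries_zero (ν : ℝ) : besselISeries ν 0 = (Real.Gamma (ν + 1))⁻¹ := by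
  unfold besselISeries
  rw [tsum_eq_single 0 (fun k hk => by simp [hk])]
  simp

theorem besselI_eq (ν : ℝ) {x : ℝ} (hx : 0 < x) :
    besselI ν x = (x / 2) ^ ν * besselISeries ν (x ^ 2 / 4) := by
  unfold besselI besselISeries
  rw [← tsum_mul_left]
  congr 1; ext k
  rw [Real.rpow_add (by positivity), mul_comm (2 : ℝ), Real.rpow_mul (by positivity),
    Real.rpow_natCast, Real.rpow_two, ← pow_mul, mul_comm k 2, pow_mul, div_pow]
  norm_num
  ring

/-- The Euler derivative `x I_ν'(x)` of the modified Bessel function of the first kind. -/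
noncomputable def besselIEuler (ν x : ℝ) : ℝ :=
  (x / 2) ^ ν * (ν * besselISeries ν (x ^ 2 / 4) + x ^ 2 / 2 * besselISeries (ν + 1) (x ^ 2 / 4))

theorem besselIEuler_pos {ν x : ℝ} (hν : 0 ≤ ν) (hx : 0 < x) : 0 < besselIEuler ν x := by
  have h1 := besselISeries_pos hν (show 0 ≤ x ^ 2 / 4 by positivity)
  have h2 := besselISeries_pos (show 0 ≤ ν + 1 by linarith) (show 0 ≤ x ^ 2 / 4 by positivity)
  have h3 : 0 < (x / 2) ^ ν := Real.rpow_pos_of_pos (by positivity) _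
  unfold besselIEuler
  positivity

theorem hasDerivAt_half_rpow (ν : ℝ) {x : ℝ} (hx : 0 < x) :
    HasDerivAt (fun y : ℝ => (y / 2) ^ ν) (ν / x * (x / 2) ^ ν) x := by
  have h2 : 0 < x / 2 := by positivity
  have := ((hasDerivAt_id x).div_const 2).rpow_const (p := ν) (Or.inl h2.ne')
  refine this.congr_deriv ?_
  simp only [id]
  rw [Real.rpow_sub_one h2.ne']
  field_simp

theorem hasDerivAt_besselISeries_comp {ν : ℝ} (hν : 0 ≤ ν) (x : ℝ) :
    HasDerivAt (fun y : ℝ => besselISeries ν (y ^ 2 / 4)) (besselISeries (ν + 1) (x ^ 2 / 4) * (x / 2)) x := by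
  have h : HasDerivAt (fun y : ℝ => y ^ 2 / 4) (x / 2) x := by
    refine ((hasDerivAt_pow 2 x).div_const 4).congr_deriv ?_
    norm_num; ring
  exact (hasDerivAt_besselISeries hν (x ^ 2 / 4)).comp x h

theorem hasDerivAt_besselI {ν x : ℝ} (hν : 0 ≤ ν) (hx : 0 < x) :
    HasDerivAt (besselI ν) (besselIEuler ν x / x) x := by
  have h := (hasDerivAt_half_rpow ν hx).mul (hasDerivAt_besselISeries_comp hν x)
  have h' : HasDerivAt (besselI ν) _ x := h.congr_of_eventuallyEq (by
    filter_upwards [lt_mem_nhds hx] with y hy using besselI_eq ν hy)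
  refine h'.congr_deriv ?_
  unfold besselIEuler
  field_simp

theorem hasDerivAt_besselIEuler {ν x : ℝ} (hν : 0 ≤ ν) (hx : 0 < x) :
    HasDerivAt (besselIEuler ν) ((x ^ 2 + ν ^ 2) * besselI ν x / x) x := by
  have hp : HasDerivAt (fun y : ℝ => y ^ 2 / 2) x x := by
    refine ((hasDerivAt_pow 2 x).div_const 2).congr_deriv ?_
    norm_num
  have h : HasDerivAt (besselIEuler ν) _ x := (hasDerivAt_half_rpow ν hx).mul
    (((hasDerivAt_besselISeries_comp hν x).const_mul ν).add
      (hp.mul (hasDerivAt_besselISeries_comp (show 0 ≤ ν + 1 by linarith) x)))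
  refine h.congr_deriv ?_
  have := besselISeries_recurrence hν (x ^ 2 / 4)
  rw [besselI_eq ν hx]
  rw [show ν + 1 + 1 = ν + 2 by ring]
  have e : (x ^ 2 + ν ^ 2) * ((x / 2) ^ ν * besselISeries ν (x ^ 2 / 4)) / x
      = (x / 2) ^ ν * (ν ^ 2 / x * besselISeries ν (x ^ 2 / 4) + x * besselISeries ν (x ^ 2 / 4)) := by
    field_simp; ring
  have e' : ν / x * (x / 2) ^ ν
        * (ν * besselISeries ν (x ^ 2 / 4) + x ^ 2 / 2 * besselISeries (ν + 1) (x ^ 2 / 4))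
      = (x / 2) ^ ν * (ν ^ 2 / x * besselISeries ν (x ^ 2 / 4)
        + ν * x / 2 * besselISeries (ν + 1) (x ^ 2 / 4)) := by
    field_simp
  rw [e, e']
  linear_combination -(x / 2) ^ ν * x * this

theorem tendsto_besselISeries_comp {ν : ℝ} (hν : 0 ≤ ν) :
    Tendsto (fun x : ℝ => besselISeries ν (x ^ 2 / 4)) (𝓝[>] 0) (𝓝 (Real.Gamma (ν + 1))⁻¹) := by
  have := (hasDerivAt_besselISeries_comp hν 0).continuousAt.tendsto
  simp only [ne_eq, OfNat.ofNat_ne_zero, not_false_eq_true, zero_pow, zero_div,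
    besselISeries_zero] at this
  exact this.mono_left nhdsWithin_le_nhds

theorem tendsto_besselIEuler_factor {ν : ℝ} (hν : 0 ≤ ν) :
    Tendsto (fun x : ℝ => ν * besselISeries ν (x ^ 2 / 4) + x ^ 2 / 2 * besselISeries (ν + 1) (x ^ 2 / 4))
      (𝓝[>] 0) (𝓝 (ν * (Real.Gamma (ν + 1))⁻¹)) := by
  have hsq : Tendsto (fun x : ℝ => x ^ 2 / 2) (𝓝[>] 0) (𝓝 0) := by
    have hc : Continuous fun x : ℝ => x ^ 2 / 2 := by fun_prop
    simpa using (hc.tendsto 0).mono_left nhdsWithin_le_nhds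
  simpa using ((tendsto_besselISeries_comp hν).const_mul ν).add
    (hsq.mul (tendsto_besselISeries_comp (show 0 ≤ ν + 1 by linarith)))

theorem tendsto_half_rpow {ν : ℝ} (hν : 0 < ν) :
    Tendsto (fun x : ℝ => (x / 2) ^ ν) (𝓝[>] 0) (𝓝 0) := by
  have hc : Continuous fun x : ℝ => (x / 2) ^ ν :=
    (continuous_id.div_const 2).rpow_const fun _ => Or.inr hν.le
  simpa [Real.zero_rpow hν.ne'] using (hc.tendsto 0).mono_left nhdsWithin_le_nhds

theorem tendsto_besselI_zero {ν : ℝ} (hν : 0 < ν) : Tendsto (besselI ν) (𝓝[>] 0) (𝓝 0) := by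
  have := (tendsto_half_rpow hν).mul (tendsto_besselISeries_comp hν.le)
  rw [zero_mul] at this
  refine this.congr' ?_
  filter_upwards [self_mem_nhdsWithin] with x hx using (besselI_eq ν hx).symm

theorem tendsto_besselIEuler_zero {ν : ℝ} (hν : 0 < ν) : Tendsto (besselIEuler ν) (𝓝[>] 0) (𝓝 0) := by
  have := (tendsto_half_rpow hν).mul (tendsto_besselIEuler_factor hν.le)
  rwa [zero_mul] at this

end FirstKind

/-! ### Sign from monotonicity and a boundary limit; the Wronskian. -/

theorem neg_of_tendsto_zero_of_hasDerivAt_neg {f f' : ℝ → ℝ}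
    (hf : ∀ x, 0 < x → HasDerivAt f (f' x) x) (hf' : ∀ x, 0 < x → f' x < 0)
    (hlim : Tendsto f (𝓝[>] 0) (𝓝 0)) {x : ℝ} (hx : 0 < x) : f x < 0 := by
  have hanti : StrictAntiOn f (Ioi 0) := by
    refine strictAntiOn_of_deriv_neg (convex_Ioi 0)
      (fun y hy => (hf y hy).continuousAt.continuousWithinAt) fun y hy => ?_
    rw [interior_Ioi] at hy
    rw [(hf y hy).deriv]
    exact hf' y hy
  -- The limit only gives f ≤ 0; the intermediate point x/2 restores strictness at x.
  have h2 : (0 : ℝ) < x / 2 := half_pos hx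
  have hle : f (x / 2) ≤ 0 := by
    refine ge_of_tendsto hlim ?_
    filter_upwards [Ioo_mem_nhdsGT h2] with y hy
    exact (hanti hy.1 h2 hy.2).le
  exact (hanti h2 hx (half_lt_self hx)).trans_le hle

theorem neg_of_tendsto_zero_of_hasDerivAt_pos {f f' : ℝ → ℝ}
    (hf : ∀ x, 0 < x → HasDerivAt f (f' x) x) (hf' : ∀ x, 0 < x → 0 < f' x)
    (hlim : Tendsto f atTop (𝓝 0)) {x : ℝ} (hx : 0 < x) : f x < 0 := by
  have hmono : StrictMonoOn f (Ioi 0) := by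
    refine strictMonoOn_of_deriv_pos (convex_Ioi 0)
      (fun y hy => (hf y hy).continuousAt.continuousWithinAt) fun y hy => ?_
    rw [interior_Ioi] at hy
    rw [(hf y hy).deriv]
    exact hf' y hy
  have h1 : (0 : ℝ) < x + 1 := by linarith
  have hle : f (x + 1) ≤ 0 := by
    refine ge_of_tendsto hlim ?_
    filter_upwards [eventually_gt_atTop (x + 1)] with y hy
    exact (hmono h1 (h1.trans hy) hy).le
  exact (hmono hx h1 (lt_add_one x)).trans_le hle

/-- The Wronskian identity `x (I_ν' K_ν - I_ν K_ν') = 1`. -/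
theorem bessel_wronskian {ν x : ℝ} (hν : 1 < ν) (hx : 0 < x) :
    besselI ν x * besselKEuler ν x + besselIEuler ν x * besselK ν x = 1 := by
  have hν0 : 0 < ν := by linarith
  set W : ℝ → ℝ := fun x => besselI ν x * besselKEuler ν x + besselIEuler ν x * besselK ν x with hW
  have hd : ∀ y ∈ Ioi (0 : ℝ), HasDerivAt W 0 y := by
    intro y hy
    refine (((hasDerivAt_besselI hν0.le hy).mul (hasDerivAt_besselKEuler ν hy)).add
      ((hasDerivAt_besselIEuler hν0.le hy).mul (hasDerivAt_besselK ν hy))).congr_deriv ?_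
    ring
  have hconst : ∀ y ∈ Ioi (0 : ℝ), W y = W x := fun y hy =>
    isOpen_Ioi.is_const_of_deriv_eq_zero isPreconnected_Ioi
      (fun y hy => (hd y hy).differentiableAt.differentiableWithinAt)
      (fun y hy => (hd y hy).deriv) hy hx
  have hlim : Tendsto W (𝓝[>] 0) (𝓝 1) := by
    -- The power (x/2)^ν from I is moved onto the K factors; each of the two products then tends to
    -- 1/2.
    have h := (((tendsto_besselISeries_comp hν0.le).mul (tendsto_rpow_mul_besselKEuler hν)).add
      ((tendsto_besselIEuler_factor hν0.le).mul (tendsto_rpow_mul_besselK hν0))).div_const 2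
    have hG : 0 < Real.Gamma (ν + 1) := Real.Gamma_pos_of_pos (by linarith)
    have hval : ((Real.Gamma (ν + 1))⁻¹ * Real.Gamma (ν + 1)
        + ν * (Real.Gamma (ν + 1))⁻¹ * Real.Gamma ν) / 2 = 1 := by
      rw [inv_mul_cancel₀ hG.ne', mul_right_comm, ← Real.Gamma_add_one hν0.ne',
        mul_inv_cancel₀ hG.ne']
      norm_num
    rw [hval] at h
    refine h.congr' ?_
    filter_upwards [self_mem_nhdsWithin] with y hy
    simp only [hW]
    rw [besselI_eq ν hy, besselIEuler]
    ring
  have hlim' : Tendsto W (𝓝[>] 0) (𝓝 (W x)) := by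
    refine tendsto_const_nhds.congr' ?_
    filter_upwards [self_mem_nhdsWithin] with y hy using (hconst y hy).symm
  exact tendsto_nhds_unique hlim' hlim

/-! ### Comparison of two orders at fixed z. -/

/-- The Euler operator x d/dx is invariant under the scaling x = νz, so functions of different
orders can be differentiated in the common variable z. -/
theorem hasDerivAt_comp_const_mul {f : ℝ → ℝ} {g ν z : ℝ} (hν : 0 < ν) (hz : 0 < z)
    (hf : HasDerivAt f (g / (ν * z)) (ν * z)) : HasDerivAt (fun z => f (ν * z)) (g / z) z := by
  have h : HasDerivAt (fun z => ν * z) ν z := by simpa using (hasDerivAt_id z).const_mul ν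
  refine (hf.comp z h).congr_deriv ?_
  field_simp

theorem tendsto_const_mul_nhdsGT_zero {ν : ℝ} (hν : 0 < ν) :
    Tendsto (fun z : ℝ => ν * z) (𝓝[>] 0) (𝓝[>] 0) := by
  refine tendsto_nhdsWithin_iff.2 ⟨?_, ?_⟩
  · have hc : Continuous fun z : ℝ => ν * z := by fun_prop
    simpa using (hc.tendsto 0).mono_left nhdsWithin_le_nhds
  · filter_upwards [self_mem_nhdsWithin] with z hz using mul_pos hν hz

/-- `ν² I_ν(νz) / (νz I_ν'(νz))` is strictly increasing in `ν`, in cross-multiplied form. -/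
theorem besselI_cross_lt {a b z : ℝ} (ha : 0 < a) (hab : a < b) (hz : 0 < z) :
    a ^ 2 * besselI a (a * z) * besselIEuler b (b * z)
      < b ^ 2 * besselI b (b * z) * besselIEuler a (a * z) := by
  have hb : 0 < b := ha.trans hab
  rw [← sub_neg]
  refine neg_of_tendsto_zero_of_hasDerivAt_neg
    (f := fun z => a ^ 2 * besselI a (a * z) * besselIEuler b (b * z)
      - b ^ 2 * besselI b (b * z) * besselIEuler a (a * z))
    (f' := fun z => (a ^ 2 - b ^ 2) * (besselIEuler a (a * z) * besselIEuler b (b * z)) / z)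
    (fun y hy => ?_) (fun y hy => ?_) ?_ hz
  · have hI : ∀ {ν : ℝ}, 0 < ν → HasDerivAt (fun z => besselI ν (ν * z)) (besselIEuler ν (ν * y) / y) y :=
      fun hν => hasDerivAt_comp_const_mul hν hy (hasDerivAt_besselI hν.le (mul_pos hν hy))
    have hw : ∀ {ν : ℝ}, 0 < ν → HasDerivAt (fun z => besselIEuler ν (ν * z))
        ((((ν * y) ^ 2 + ν ^ 2) * besselI ν (ν * y)) / y) y :=
      fun hν => hasDerivAt_comp_const_mul hν hy (hasDerivAt_besselIEuler hν.le (mul_pos hν hy))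
    refine ((((hI ha).const_mul (a ^ 2)).mul (hw hb)).sub
      (((hI hb).const_mul (b ^ 2)).mul (hw ha))).congr_deriv ?_
    field_simp
    ring
  · have h1 := besselIEuler_pos ha.le (mul_pos ha hy)
    have h2 := besselIEuler_pos hb.le (mul_pos hb hy)
    have h3 : a ^ 2 - b ^ 2 < 0 := by nlinarith
    exact div_neg_of_neg_of_pos (mul_neg_of_neg_of_pos h3 (mul_pos h1 h2)) hy
  · have hI : ∀ {ν : ℝ}, 0 < ν → Tendsto (fun z => besselI ν (ν * z)) (𝓝[>] 0) (𝓝 0) :=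
      fun hν => (tendsto_besselI_zero hν).comp (tendsto_const_mul_nhdsGT_zero hν)
    have hw : ∀ {ν : ℝ}, 0 < ν → Tendsto (fun z => besselIEuler ν (ν * z)) (𝓝[>] 0) (𝓝 0) :=
      fun hν => (tendsto_besselIEuler_zero hν).comp (tendsto_const_mul_nhdsGT_zero hν)
    simpa using (((hI ha).const_mul (a ^ 2)).mul (hw hb)).sub
      (((hI hb).const_mul (b ^ 2)).mul (hw ha))

/-- `-ν² K_ν(νz) / (νz K_ν'(νz))` is strictly increasing in `ν`, in cross-multiplied form. -/
theorem besselK_cross_lt {a b z : ℝ} (ha : 0 < a) (hab : a < b) (hz : 0 < z) :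
    a ^ 2 * besselK a (a * z) * besselKEuler b (b * z)
      < b ^ 2 * besselK b (b * z) * besselKEuler a (a * z) := by
  have hb : 0 < b := ha.trans hab
  rw [← sub_neg]
  refine neg_of_tendsto_zero_of_hasDerivAt_pos
    (f := fun z => a ^ 2 * besselK a (a * z) * besselKEuler b (b * z)
      - b ^ 2 * besselK b (b * z) * besselKEuler a (a * z))
    (f' := fun z => (b ^ 2 - a ^ 2) * (besselKEuler a (a * z) * besselKEuler b (b * z)) / z)
    (fun y hy => ?_) (fun y hy => ?_) ?_ hz
  · have hK : ∀ {ν : ℝ}, 0 < ν → HasDerivAt (fun z => besselK ν (ν * z)) (-besselKEuler ν (ν * y) / y) y :=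
      fun hν => hasDerivAt_comp_const_mul hν hy (hasDerivAt_besselK _ (mul_pos hν hy))
    have hm : ∀ {ν : ℝ}, 0 < ν → HasDerivAt (fun z => besselKEuler ν (ν * z))
        (-(((ν * y) ^ 2 + ν ^ 2) * besselK ν (ν * y)) / y) y :=
      fun hν => hasDerivAt_comp_const_mul hν hy (hasDerivAt_besselKEuler _ (mul_pos hν hy))
    refine ((((hK ha).const_mul (a ^ 2)).mul (hm hb)).sub
      (((hK hb).const_mul (b ^ 2)).mul (hm ha))).congr_deriv ?_
    field_simp
    ring
  · have h1 := besselKEuler_pos a (mul_pos ha hy)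
    have h2 := besselKEuler_pos b (mul_pos hb hy)
    have h3 : 0 < b ^ 2 - a ^ 2 := by nlinarith
    exact div_pos (mul_pos h3 (mul_pos h1 h2)) hy
  · have hK : ∀ {ν : ℝ}, 0 < ν → Tendsto (fun z => besselK ν (ν * z)) atTop (𝓝 0) :=
      fun hν => (tendsto_besselK_atTop _).comp (tendsto_id.const_mul_atTop hν)
    have hm : ∀ {ν : ℝ}, 0 < ν → Tendsto (fun z => besselKEuler ν (ν * z)) atTop (𝓝 0) :=
      fun hν => (tendsto_besselKEuler_atTop _).comp (tendsto_id.const_mul_atTop hν)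
    simpa using (((hK ha).const_mul (a ^ 2)).mul (hm hb)).sub
      (((hK hb).const_mul (b ^ 2)).mul (hm ha))

/-! ### Monotonicity of the product. -/

theorem besselDerivProd_eq {z ν : ℝ} (hz : 0 < z) (hν : 0 < ν) :
    besselDerivProd z ν
      = -(besselIEuler ν (ν * z) * besselKEuler ν (ν * z) / ν ^ 2) / z ^ 2 := by
  have h := mul_pos hν hz
  unfold besselDerivProd
  rw [(hasDerivAt_besselI hν.le h).deriv, (hasDerivAt_besselK ν h).deriv]
  field_simp

theorem inv_besselEuler_prod {z ν : ℝ} (hz : 0 < z) (hν : 1 < ν) :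
    (besselIEuler ν (ν * z) * besselKEuler ν (ν * z) / ν ^ 2)⁻¹
      = ν ^ 2 * besselI ν (ν * z) / besselIEuler ν (ν * z)
        + ν ^ 2 * besselK ν (ν * z) / besselKEuler ν (ν * z) := by
  have hν0 : 0 < ν := by linarith
  have h := mul_pos hν0 hz
  have hw := (besselIEuler_pos hν0.le h).ne'
  have hm := (besselKEuler_pos ν h).ne'
  rw [inv_div, div_add_div _ _ hw hm]
  congr 1
  linear_combination -ν ^ 2 * bessel_wronskian hν h

/-- The monotonicity holds for every `z > 0` on the whole range `ν > 1`. -/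
theorem strictMonoOn_besselDerivProd {z : ℝ} (hz : 0 < z) :
    StrictMonoOn (fun ν => besselDerivProd z ν) (Ioi 1) := by
  intro a ha b hb hab
  have ha1 : 1 < a := ha
  have hb1 : 1 < b := hb
  have ha0 : 0 < a := by linarith
  have hb0 : 0 < b := by linarith
  have hwa := besselIEuler_pos ha0.le (mul_pos ha0 hz)
  have hwb := besselIEuler_pos hb0.le (mul_pos hb0 hz)
  have hma := besselKEuler_pos a (mul_pos ha0 hz)
  have hmb := besselKEuler_pos b (mul_pos hb0 hz)
  simp only
  rw [besselDerivProd_eq hz ha0, besselDerivProd_eq hz hb0]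
  refine div_lt_div_of_pos_right (neg_lt_neg ?_) (by positivity)
  -- Passing to reciprocals turns the product into the sum of two increasing ratios.
  rw [← inv_lt_inv₀ (by positivity) (by positivity), inv_besselEuler_prod hz ha1,
    inv_besselEuler_prod hz hb1]
  exact add_lt_add ((div_lt_div_iff₀ hwa hwb).2 (besselI_cross_lt ha0 hab hz))
    ((div_lt_div_iff₀ hma hmb).2 (besselK_cross_lt ha0 hab hz))

theorem proposition3p6 :
    ∃ (A₁ A₂ : ℝ) (M : ℝ → ℝ), 0 < A₁ ∧ 0 < A₂ ∧ (∀ z : ℝ, 0 < z → 0 < M z) ∧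
      (∀ z : ℝ, 0 < z → z < A₁ → StrictMonoOn (fun ν : ℝ => besselDerivProd z ν) (Set.Ici 2)) ∧
      (∀ z : ℝ, A₂ < z → StrictMonoOn (fun ν : ℝ => besselDerivProd z ν) (Set.Ici 2)) ∧
      (∀ z : ℝ, 0 < z → StrictMonoOn (fun ν : ℝ => besselDerivProd z ν) (Set.Ioi (M z))) := by
  have hIci : Ici (2 : ℝ) ⊆ Ioi 1 := Ici_subset_Ioi.2 one_lt_two
  -- Any positive constants A₁ and A₂ would do; M = 1 is the bound on ν coming from the Wronskian.
  exact ⟨1, 1, fun _ => 1, one_pos, one_pos, fun _ _ => one_pos,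
    fun z hz _ => (strictMonoOn_besselDerivProd hz).mono hIci,
    fun z hz => (strictMonoOn_besselDerivProd (one_pos.trans hz)).mono hIci,
    fun z hz => strictMonoOn_besselDerivProd hz⟩
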